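/- Let $E$ be a biordered set in the sense of Nambooripad. Thus $E$ is a set with a partial binary operation, and with the relations $e\,\omega^l f \iff ef=e$ and $e\,\omega^r f \iff fe=e$ (it being part of the condition that the product is defined) it satisfies Nambooripad's biordered set axioms. Put $\omega=\omega^l\cap\omega^r$. For $e,f\in E$ let $$M(e,f)=\{g\in E : g\,\omega^l e \text{ and } g\,\omega^r f\},$$ $$S(e,f)=\{h\in M(e,f) : eg\,\omega^r eh \text{ and } gf\,\omega^l hf \text{ for all } g\in M(e,f)\}.$$ Suppose that $E$ is regular, that is, $S(e,f)\neq\emptyset$ for all $e,f\in E$, and that * (E1) there is an element $0\in E$ with $0\,\omega\,e$ for every $e\in E$; * (E2) there is a map $e\mapsto e'$ from $E$ to $E$ such that for all $e,f\in E$: (i) $e''=e$; (ii) $f\,\omega^l e$ if and only if $e'\,\omega^r f'$; (iii) $f\,\omega^l e'$ if and only if $M(f,e)=\{0\}$. Then there is a strongly regular Baer semigroup $S$ such that $E$ is (isomorphic to) the biordered set of idempotents of $S$. Moreover, $S$ can be taken to be regular and idempotent-generated; and every regular idempotent-generated semigroup whose biordered set of idempotents is isomorphic to $E$ is a strongly regular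 Baer semigroup. Here the biordered set of idempotents of a semigroup $S$ is its set of idempotents with the product $ef$ of $S$, regarded as defined exactly when $ef=e$, $ef=f$, $fe=e$ or $fe=f$ in $S$; an isomorphism is a bijection that preserves and reflects the definedness of products and preserves the products. A semigroup $S$ is regular if for every $x\in S$ there is $x'\in S$ with $xx'x=x$; it is idempotent-generated if every element is a product of finitely many idempotents. It is a strongly regular Baer semigroup if it has a zero element, the set of left annihilators $\{x\in S : xs=0\}$ of elements $s\in S$ equals the set of principal left ideals of $S$, and the set of right annihilators $\{x\in S : sx=0\}$ of elements $s\in S$ equals the set of principal right ideals of $S$. -/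

import Mathlib

universe u v

namespace Biorder

section PartialAlgebra

/- A partial binary operation on `E` is a map `op : E → E → Option E`:
`op e f = some g` means that the product `ef` is defined and equal to `g`,
and `op e f = none` means that `ef` is not defined. -/
variable {E : Type u} (op : E → E → Option E)

/-- `e ω^l f`: the product `ef` is defined and `ef = e`. -/
def OmL (e f : E) : Prop := op e f = some e

/-- `e ω^r f`: the product `fe` is defined and `fe = e`. -/
def OmR (e f : E) : Prop := op f e = some e

/-- `e ω f`, where `ω = ω^l ∩ ω^r`. -/
def Om (e f : E) : Prop := OmL op e f ∧ OmR op e f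

/-- `M(e,f) = ω^l(e) ∩ ω^r(f)`. -/
def MSet (e f : E) : Set E := {g | OmL op g e ∧ OmR op g f}

/-- `g ≼ h` (with respect to `e`, `f`): `eg ω^r eh` and `gf ω^l hf`. -/
def SandwichLE (e f g h : E) : Prop :=
  (∃ a b, op e g = some a ∧ op e h = some b ∧ OmR op a b) ∧
  (∃ a b, op g f = some a ∧ op h f = some b ∧ OmL op a b)

/-- The sandwich set `S(e,f)`. -/
def SandwichSet (e f : E) : Set E :=
  {h | h ∈ MSet op e f ∧ ∀ g ∈ MSet op e f, SandwichLE op e f g h}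

/-- Nambooripad's axioms of a biordered set. Each axiom from `b21` on is followed by its left-right
dual (`'`), which exchanges `ω^l` with `ω^r` and reverses the order of all products.
(By `b1` every product that occurs in the axioms is defined.) -/
structure IsBiorderedSet : Prop where
  omL_refl : ∀ e, OmL op e e
  omR_refl : ∀ e, OmR op e e
  omL_trans : ∀ e f g, OmL op e f → OmL op f g → OmL op e g
  omR_trans : ∀ e f g, OmR op e f → OmR op f g → OmR op e g
  /-- The domain of the operation is `(ω^l ∪ ω^r) ∪ (ω^l ∪ ω^r)⁻¹`. -/
  b1 : ∀ e f, (∃ g, op e f = some g) ↔ (OmL op e f ∨ OmR op e f) ∨ (OmL op f e ∨ OmR op f e)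
  /-- If `f ∈ ω^r(e)` then `f R fe ω e`, where `R = ω^r ∩ (ω^r)⁻¹`. -/
  b21 : ∀ e f, OmR op f e → ∃ k, op f e = some k ∧ (OmR op f k ∧ OmR op k f) ∧ Om op k e
  b21' : ∀ e f, OmL op f e → ∃ k, op e f = some k ∧ (OmL op f k ∧ OmL op k f) ∧ Om op k e
  /-- If `f, g ∈ ω^r(e)` and `g ω^l f` then `ge ω^l fe`. -/
  b22 : ∀ e f g a b, OmR op f e → OmR op g e → OmL op g f →
    op g e = some a → op f e = some b → OmL op a b
  b22' : ∀ e f g a b, OmL op f e → OmL op g e → OmR op g f →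
    op e g = some a → op e f = some b → OmR op a b
  /-- If `g ω^r f ω^r e` then `gf = (ge)f`. -/
  b31 : ∀ e f g k, OmR op g f → OmR op f e → op g e = some k → op g f = op k f
  b31' : ∀ e f g k, OmL op g f → OmL op f e → op e g = some k → op f g = op f k
  /-- If `f, g ∈ ω^r(e)` and `g ω^l f` then `(fg)e = (fe)(ge)`. -/
  b32 : ∀ e f g k a b, OmR op f e → OmR op g e → OmL op g f →
    op f g = some k → op f e = some a → op g e = some b → op k e = op a b
  b32' : ∀ e f g k a b, OmL op f e → OmL op g e → OmR op g f →
    op g f = some k → op e f = some a → op e g = some b → op e k = op b a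
  /-- If `f, g ∈ ω^r(e)` then `S(f,g)e = S(fe,ge)`. -/
  b4 : ∀ e f g a b, OmR op f e → OmR op g e → op f e = some a → op g e = some b →
    {k | ∃ h ∈ SandwichSet op f g, op h e = some k} = SandwichSet op a b
  b4' : ∀ e f g a b, OmL op f e → OmL op g e → op e f = some a → op e g = some b →
    {k | ∃ h ∈ SandwichSet op f g, op e h = some k} = SandwichSet op a b

/-- A biordered set is regular if all its sandwich sets are non-empty. -/
structure IsRegularBiorderedSet : Prop extends IsBiorderedSet op where
  sandwich_nonempty : ∀ e f, (SandwichSet op e f).Nonempty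

end PartialAlgebra

section Semigroups

variable (S : Type v) [Semigroup S]

/-- The set `E(S)` of idempotents of a semigroup. -/
abbrev Idem : Type v := {e : S // IsIdempotentElem e}

variable {S}

/-- The pairs of idempotents with a product in the biordered set `E(S)`:
those with `ef = e`, `ef = f`, `fe = e` or `fe = f` in `S`. -/
def Comparable (e f : Idem S) : Prop :=
  (e : S) * f = e ∨ (e : S) * f = f ∨ (f : S) * e = e ∨ (f : S) * e = f

theorem Comparable.isIdempotentElem_mul {e f : Idem S} (h : Comparable e f) :
    IsIdempotentElem ((e : S) * f) := by
  obtain ⟨e, he⟩ := e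
  obtain ⟨f, hf⟩ := f
  unfold IsIdempotentElem at *
  rcases h with h | h | h | h <;> simp only at h ⊢
  · rw [h, he]
  · rw [h, hf]
  · rw [mul_assoc, ← mul_assoc f, h, ← mul_assoc, he]
  · rw [mul_assoc, ← mul_assoc f, h, hf]

open Classical in
/-- The partial operation of the biordered set `E(S)` of idempotents of `S`: the product of `S`,
restricted to the comparable pairs. -/
noncomputable def idemOp (e f : Idem S) : Option (Idem S) :=
  if h : Comparable e f then some ⟨(e : S) * f, h.isIdempotentElem_mul⟩ else none

variable (S)

/-- `E`, with the partial operation `op`, is (isomorphic to) the biordered set of idempotents of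
`S`: there is a bijection from `E` onto `E(S)` that preserves and reflects definedness of products,
and preserves the products. -/
def IsBiorderedSetOfIdempotents {E : Type u} (op : E → E → Option E) : Prop :=
  ∃ φ : E ≃ Idem S, ∀ e f, idemOp (φ e) (φ f) = (op e f).map φ

/-- Every element `x` has some `x'` with `xx'x = x`. -/
def IsRegularSemigroup : Prop := ∀ x : S, ∃ x' : S, x * x' * x = x

/-- Every element is a product of finitely many (at least one) idempotents. -/
def IsIdempotentGenerated : Prop := Subsemigroup.closure {e : S | IsIdempotentElem e} = ⊤

variable {S}

/-- The left annihilator of `s`, where `z` is the zero of the semigroup. -/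
def leftAnn (z s : S) : Set S := {x | x * s = z}

/-- The right annihilator of `s`, where `z` is the zero of the semigroup. -/
def rightAnn (z s : S) : Set S := {x | s * x = z}

/-- The left ideal `S¹s = {s} ∪ Ss` generated by `s` (it is `Ss` if `S` is regular). -/
def principalLeftIdeal (s : S) : Set S := {x | x = s ∨ ∃ t, x = t * s}

/-- The right ideal `sS¹ = {s} ∪ sS` generated by `s` (it is `sS` if `S` is regular). -/
def principalRightIdeal (s : S) : Set S := {x | x = s ∨ ∃ t, x = s * t}

variable (S)

/-- `S` has a zero `z`, the left annihilators of elements are exactly the principal left ideals, and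
the right annihilators of elements are exactly the principal right ideals. -/
def IsStronglyRegularBaer : Prop :=
  ∃ z : S, (∀ x, z * x = z ∧ x * z = z) ∧
    Set.range (leftAnn z) = Set.range (principalLeftIdeal (S := S)) ∧
    Set.range (rightAnn z) = Set.range (principalRightIdeal (S := S))

end Semigroups

end Biorder

/-!
The theorem does not need Nambooripad's construction of a semigroup from an arbitrary regular
biordered set: here the semigroup is found inside the normal maps of a complemented modular lattice.

Let `L = E/𝓛`, ordered by `ω^l`. Each `e` acts on `L` by right multiplication: the class of `f` goes
to the class of `he`, for `h ∈ S(f,e)`. The condition (E2) turns left multiplication on `E/𝓡` into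
a residual of this map, because "`(fe)g = 0` iff `f(eg) = 0`" holds in the sense of sandwich
sets (`omL_compl_assoc`, which rests on the axiom `S(f,g)e = S(fe,ge)`). The action of `e` fixes
`[⊥, e]`, and its residual fixes `[e', ⊤]`. Hence the two composites of these maps are meets with `e`
and joins with `e'`; so `L` is a lattice, `e` and `e'` are complements in it, and `e` acts as
`x ↦ (x ⊔ e') ⊓ e`. Every complementary pair is of the form `(e, e')`: if the classes of `f` and `e'`
are complementary, then every `h ∈ S(f,e)` is `𝓛`-equivalent to `f` and `𝓡`-equivalent to `e`
(`omL_sandwich_of_disjoint` and its dual). In particular complementary pairs are modular pairs, and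
together with antitone choices of complements this makes `L` modular
(`isModularLattice_of_isCompl`).

On a complemented modular lattice the normal maps, which are the isomorphisms of an upper interval
`[k, ⊤]` onto a lower interval `[⊥, a]`, form a regular monoid whose idempotents are the
projections `x ↦ (x ⊔ v) ⊓ n` with `n` and `v` complementary. So its biordered set is that of the
complementary pairs, that is `E`, and it remains to pass to the subsemigroup generated by the
idempotents, which is again regular (`isRegularSemigroup_closure`).

Finally, in a regular idempotent-generated semigroup with biordered set `E` the products
satisfy `fe = 0` iff `M(f,e) = {0}`. With (E2) the left annihilator of an idempotent `e` is therefore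
the left ideal of `e'`, and dually; regularity reduces all annihilators and principal ideals to those
of idempotents.
-/

namespace Biorder

/-! ### Duality and sandwich sets -/

section PartialAlgebra

variable {E : Type u} {op : E → E → Option E} {zero : E} {compl : E → E}

/-- The partial operation with the order of all products reversed. It exchanges `ω^l` with `ω^r`
(definitionally) and `S(e,f)` with `S(f,e)`. -/
abbrev dualOp (op : E → E → Option E) : E → E → Option E := fun e f => op f e

theorem sandwichSet_dualOp (e f : E) : SandwichSet (dualOp op) e f = SandwichSet op f e := by
  ext h
  constructor <;> rintro ⟨⟨h1, h2⟩, h3⟩ <;>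
    exact ⟨⟨h2, h1⟩, fun g hg => ⟨(h3 g ⟨hg.2, hg.1⟩).2, (h3 g ⟨hg.2, hg.1⟩).1⟩⟩

/-- If `h ∈ S(f,e)` then `he` dominates all `ge` with `g ∈ M(f,e)`. -/
theorem omL_of_mem_sandwichSet {e f g h a m : E}
    (hh : h ∈ SandwichSet op f e) (hm : op h e = some m) (hg : g ∈ MSet op f e)
    (ha : op g e = some a) : OmL op a m := by
  obtain ⟨-, a', m', ha', hm', h1⟩ := hh.2 g hg
  obtain rfl : a = a' := Option.some_injective _ (ha.symm.trans ha')
  obtain rfl : m = m' := Option.some_injective _ (hm.symm.trans hm')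
  exact h1

theorem IsRegularBiorderedSet.dual (hE : IsRegularBiorderedSet op) :
    IsRegularBiorderedSet (dualOp op) where
  omL_refl := hE.omR_refl
  omR_refl := hE.omL_refl
  omL_trans := hE.omR_trans
  omR_trans := hE.omL_trans
  b1 e f := by
    refine (hE.b1 f e).trans ?_
    change _ ↔ (OmR op e f ∨ OmL op e f) ∨ (OmR op f e ∨ OmL op f e)
    tauto
  b21 e f h := by
    obtain ⟨k, h1, h2, h3, h4⟩ := hE.b21' e f h
    exact ⟨k, h1, h2, h4, h3⟩
  b21' e f h := by
    obtain ⟨k, h1, h2, h3, h4⟩ := hE.b21 e f h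
    exact ⟨k, h1, h2, h4, h3⟩
  b22 := hE.b22'
  b22' := hE.b22
  b31 := hE.b31'
  b31' := hE.b31
  b32 := hE.b32'
  b32' := hE.b32
  b4 e f g a b hf hg ha hb := by
    rw [sandwichSet_dualOp (op := op) f g, sandwichSet_dualOp (op := op) a b]
    exact hE.b4' e g f b a hg hf hb ha
  b4' e f g a b hf hg ha hb := by
    rw [sandwichSet_dualOp (op := op) f g, sandwichSet_dualOp (op := op) a b]
    exact hE.b4 e g f b a hg hf hb ha
  sandwich_nonempty e f := by
    rw [sandwichSet_dualOp]
    exact hE.sandwich_nonempty f e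

/-- A regular biordered set with a zero (condition (E1)) and a map `e ↦ e'` as in condition (E2):
an involution that exchanges `ω^l` with the reverse of `ω^r`, and for which the elements `ω^l`-below
`e'` are those that annihilate `e` from the left. -/
structure IsBaerBiorderedSet (op : E → E → Option E) (zero : E) (compl : E → E) : Prop extends
    IsRegularBiorderedSet op where
  zero_om : ∀ e, Om op zero e
  compl_compl : ∀ e, compl (compl e) = e
  omL_iff : ∀ e f, OmL op f e ↔ OmR op (compl e) (compl f)
  omL_compl_iff : ∀ e f, OmL op f (compl e) ↔ MSet op f e = {zero}

namespace IsBaerBiorderedSet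

theorem omR_iff (H : IsBaerBiorderedSet op zero compl) (e f : E) :
    OmR op f e ↔ OmL op (compl e) (compl f) := by
  rw [H.omL_iff, H.compl_compl, H.compl_compl]

theorem omR_compl_iff (H : IsBaerBiorderedSet op zero compl) (e f : E) :
    OmR op f (compl e) ↔ MSet op e f = {zero} := by
  rw [H.omR_iff, H.compl_compl, H.omL_compl_iff]

theorem dual (H : IsBaerBiorderedSet op zero compl) :
    IsBaerBiorderedSet (dualOp op) zero compl where
  toIsRegularBiorderedSet := H.toIsRegularBiorderedSet.dual
  zero_om e := (H.zero_om e).symm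
  compl_compl := H.compl_compl
  omL_iff := H.omR_iff
  omL_compl_iff e f := by
    have : MSet (dualOp op) f e = MSet op e f := Set.ext fun g => and_comm
    rw [this]
    exact H.omR_compl_iff e f

theorem eq_zero_of_omL (H : IsBaerBiorderedSet op zero compl) {p : E} (h : OmL op p zero) :
    p = zero :=
  Option.some_injective _ (h.symm.trans (H.zero_om p).2)

theorem eq_zero_of_omR (H : IsBaerBiorderedSet op zero compl) {p : E} (h : OmR op p zero) :
    p = zero :=
  H.dual.eq_zero_of_omL h

theorem mSet_eq_zero_iff (H : IsBaerBiorderedSet op zero compl) {e f : E} :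
    MSet op e f = {zero} ↔ ∀ p, OmL op p e → OmR op p f → p = zero := by
  constructor
  · intro h p h1 h2
    exact h.subset ⟨h1, h2⟩
  · intro h
    ext p
    refine ⟨fun hp => h p hp.1 hp.2, ?_⟩
    rintro rfl
    exact ⟨(H.zero_om e).1, (H.zero_om f).2⟩

theorem omL_compl_iff' (H : IsBaerBiorderedSet op zero compl) {e f : E} :
    OmL op f (compl e) ↔ ∀ p, OmL op p f → OmR op p e → p = zero := by
  rw [H.omL_compl_iff, H.mSet_eq_zero_iff]

/-- The lifting property hidden in the axiom `S(f,g)e = S(fe,ge)`: an element `ω^l`-below `he` comes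
from an element `ω^l`-below `h`. -/
theorem exists_lift (H : IsBaerBiorderedSet op zero compl) {e h m q r : E} (he : OmR op h e)
    (hm : op h e = some m) (hq : OmR op q e) (hr : op q e = some r) (hrm : OmL op r m) :
    ∃ p, OmL op p h ∧ OmR op p q ∧ op p e = some r := by
  have hS : r ∈ SandwichSet op m r := by
    refine ⟨⟨hrm, H.omR_refl r⟩, fun g hg => ⟨?_, ?_⟩⟩
    · obtain ⟨a, ha, -⟩ := H.b21' m g hg.1
      obtain ⟨b, hb, -⟩ := H.b21' m r hrm
      exact ⟨a, b, ha, hb, H.b22' m r g a b hrm hg.1 hg.2 ha hb⟩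
    · obtain ⟨a, ha, -, hb⟩ := H.b21 r g hg.2
      exact ⟨a, r, ha, H.omL_refl r, hb.1⟩
  rw [← H.b4 e h q m r he hq hm hr] at hS
  obtain ⟨p, hp, hpe⟩ := hS
  exact ⟨p, hp.1.1, hp.1.2, hpe⟩

/-- One half of "`(fe)g = 0` iff `f(eg) = 0`": every element of `M(he,g)` gives rise to one of
`M(f,ek)`. -/
theorem eq_zero_of_forall_mSet (H : IsBaerBiorderedSet op zero compl) {e f g h k m n : E}
    (hh : h ∈ MSet op f e) (hm : op h e = some m) (hk : k ∈ SandwichSet op e g)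
    (hn : op e k = some n) (h0 : ∀ p, OmL op p f → OmR op p n → p = zero) :
    ∀ q, OmL op q m → OmR op q g → q = zero := by
  intro q hqm hqg
  obtain ⟨m', hm', -, hme⟩ := H.b21 e h hh.2
  obtain rfl : m = m' := Option.some_injective _ (hm.symm.trans hm')
  have hqe : OmL op q e := H.omL_trans _ _ _ hqm hme.1
  obtain ⟨r, hr, hqr, hre⟩ := H.b21' e q hqe
  obtain ⟨⟨a, b, ha, hb, hab⟩, -⟩ := hk.2 q ⟨hqe, hqg⟩
  obtain rfl : r = a := Option.some_injective _ (hr.symm.trans ha)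
  obtain rfl : n = b := Option.some_injective _ (hn.symm.trans hb)
  obtain ⟨p, hph, hpr, hpe⟩ := H.exists_lift hh.2 hm hre.2 hre.1 (H.omL_trans _ _ _ hqr.2 hqm)
  obtain rfl := h0 p (H.omL_trans _ _ _ hph hh.1) (H.omR_trans _ _ _ hpr hab)
  obtain rfl : p = r := Option.some_injective _ ((H.zero_om e).1.symm.trans hpe)
  exact H.eq_zero_of_omL hqr.1

/-- "`(fe)g = 0` iff `f(eg) = 0`", where `fe` is replaced by the `𝓛`-equivalent `he` with
`h ∈ S(f,e)`, and `eg` by the `𝓡`-equivalent `ek` with `k ∈ S(e,g)`. -/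
theorem omL_compl_assoc (H : IsBaerBiorderedSet op zero compl) {e f g h k m n : E}
    (hh : h ∈ SandwichSet op f e) (hm : op h e = some m) (hk : k ∈ SandwichSet op e g)
    (hn : op e k = some n) : OmL op m (compl g) ↔ OmL op f (compl n) := by
  rw [H.omL_compl_iff', H.omL_compl_iff']
  refine ⟨fun h0 q hqf hqn => ?_, fun h0 => H.eq_zero_of_forall_mSet hh.1 hm hk hn h0⟩
  exact H.dual.eq_zero_of_forall_mSet (e := e) (f := g) (g := f) (h := k) (k := h)
    ⟨hk.1.2, hk.1.1⟩ hn (by rwa [sandwichSet_dualOp]) hm (fun p h1 h2 => h0 p h2 h1) q hqn hqf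

/-- For every `h` in a sandwich set `S(f,e)` the product `he` is defined. -/
theorem exists_mul_right (H : IsBaerBiorderedSet op zero compl) {e f h : E}
    (hh : h ∈ SandwichSet op f e) :
    ∃ m, op h e = some m ∧ (OmR op h m ∧ OmR op m h) ∧ Om op m e :=
  H.b21 e h hh.1.2

theorem exists_mul_left (H : IsBaerBiorderedSet op zero compl) {e f h : E}
    (hh : h ∈ SandwichSet op f e) :
    ∃ m, op f h = some m ∧ (OmL op h m ∧ OmL op m h) ∧ Om op m f :=
  H.b21' f h hh.1.1

/-- If `f ω^r e` then `fe` itself is `𝓛`-equivalent to `he` for `h ∈ S(f,e)`. -/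
theorem omL_mul_of_omR (H : IsBaerBiorderedSet op zero compl) {e f h m a : E} (hf : OmR op f e)
    (hh : h ∈ SandwichSet op f e) (hm : op h e = some m) (ha : op f e = some a) :
    OmL op m a ∧ OmL op a m :=
  ⟨H.b22 e f h m a hf hh.1.2 hh.1.1 hm ha, omL_of_mem_sandwichSet hh hm ⟨H.omL_refl f, hf⟩ ha⟩

theorem omR_mul_of_omL (H : IsBaerBiorderedSet op zero compl) {e f h m a : E} (hf : OmL op f e)
    (hh : h ∈ SandwichSet op e f) (hm : op e h = some m) (ha : op e f = some a) :
    OmR op m a ∧ OmR op a m :=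
  H.dual.omL_mul_of_omR hf (by rwa [sandwichSet_dualOp]) hm ha

/-- If `f ω^l e` then `f` is `𝓛`-equivalent to `he` for `h ∈ S(f,e)`. -/
theorem omL_mul_of_omL (H : IsBaerBiorderedSet op zero compl) {e f h m : E} (hf : OmL op f e)
    (hh : h ∈ SandwichSet op f e) (hm : op h e = some m) :
    OmL op m f ∧ OmL op f m := by
  -- `f` may be replaced by `ef`, which is `𝓛`-equivalent to `f` and lies below `e`.
  obtain ⟨a, -, ⟨hfa, haf⟩, hae⟩ := H.b21' e f hf
  refine ⟨H.omL_trans _ _ _ ?_ haf, H.omL_trans _ _ _ hfa ?_⟩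
  · exact H.b22 e a h m a hae.2 hh.1.2 (H.omL_trans _ _ _ hh.1.1 hfa) hm hae.1
  · exact omL_of_mem_sandwichSet hh hm ⟨haf, hae.2⟩ hae.1

theorem omR_mul_of_omR (H : IsBaerBiorderedSet op zero compl) {e g k n : E} (hg : OmR op g e)
    (hk : k ∈ SandwichSet op e g) (hn : op e k = some n) :
    OmR op n g ∧ OmR op g n :=
  H.dual.omL_mul_of_omL hg (by rwa [sandwichSet_dualOp]) hn

/-- If nothing but zero is `ω^l`-below both `f` and `e'`, then the elements of `S(f,e)` are
`𝓛`-equivalent to `f`. -/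
theorem omL_sandwich_of_disjoint (H : IsBaerBiorderedSet op zero compl) {e f h : E}
    (hh : h ∈ SandwichSet op f e)
    (h0 : ∀ p, OmL op p f → OmL op p (compl e) → p = zero) : OmL op f h := by
  obtain ⟨k, hk, ⟨hhk, hkh⟩, hkf⟩ := H.exists_mul_left hh
  -- It is enough that `k = fh ω f` equals `f`, and for this that `k' ω^l f'`.
  suffices hc : OmL op (compl k) (compl f) by
    rw [← H.omR_iff] at hc
    obtain rfl : k = f := Option.some_injective _ (hkf.1.symm.trans hc)
    exact hkh
  obtain ⟨j, hj⟩ := H.sandwich_nonempty (compl k) f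
  obtain ⟨m, hm, ⟨hjm, hmj⟩, hmf⟩ := H.exists_mul_right hj
  obtain ⟨l, hl⟩ := H.sandwich_nonempty f k
  obtain ⟨n, hn, -, -⟩ := H.exists_mul_left hl
  have hnk := H.omR_mul_of_omR hkf.2 hl hn
  -- `m = jf` stands for `k'f`, which lies below `f` and below `k'`, and so also below `e'`.
  have hmk : OmL op m (compl k) := by
    rw [H.omL_compl_assoc hj hm hl hn, ← H.omR_iff]
    exact hnk.1
  have hm0 : m = zero := by
    refine h0 m hmf.1 (H.omL_compl_iff'.2 fun q hqm hqe => ?_)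
    have hqf := H.omL_trans _ _ _ hqm hmf.1
    obtain ⟨⟨a, b, ha, hb, hab⟩, -⟩ := hh.2 q ⟨hqf, hqe⟩
    obtain rfl : k = b := Option.some_injective _ (hk.symm.trans hb)
    obtain ⟨a', ha', ⟨hqa, haq⟩, -⟩ := H.b21' f q hqf
    obtain rfl : a = a' := Option.some_injective _ (ha.symm.trans ha')
    obtain rfl := H.omL_compl_iff'.1 hmk a (H.omL_trans _ _ _ haq hqm) hab
    exact H.eq_zero_of_omL hqa
  subst hm0
  refine H.omL_compl_iff'.2 fun g hgk hgf => ?_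
  obtain ⟨a, ha, ⟨hga, -⟩, -⟩ := H.b21 f g hgf
  obtain rfl := H.eq_zero_of_omL (omL_of_mem_sandwichSet hj hm ⟨hgk, hgf⟩ ha)
  exact H.eq_zero_of_omR hga

theorem omR_sandwich_of_disjoint (H : IsBaerBiorderedSet op zero compl) {e f h : E}
    (hh : h ∈ SandwichSet op e f)
    (h0 : ∀ p, OmR op p f → OmR op p (compl e) → p = zero) : OmR op f h :=
  H.dual.omL_sandwich_of_disjoint (by rwa [sandwichSet_dualOp]) h0

end IsBaerBiorderedSet

end PartialAlgebra

/-! ### Normal maps of a modular lattice -/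

section Lattice

variable {L : Type u} [Lattice L] [BoundedOrder L]

theorem _root_.IsCompl.sup_inf_eq_of_le [IsModularLattice L] {n v x : L} (h : IsCompl n v)
    (hx : x ≤ n) : (x ⊔ v) ⊓ n = x := by
  rw [sup_inf_assoc_of_le v hx, inf_comm, h.inf_eq_bot, sup_bot_eq]

theorem _root_.IsCompl.inf_sup_eq_of_le [IsModularLattice L] {n v x : L} (h : IsCompl n v)
    (hx : v ≤ x) : (x ⊓ n) ⊔ v = x := by
  rw [inf_sup_assoc_of_le n hx, h.sup_eq_top, inf_top_eq]

variable (L) in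
/-- A normal map of a bounded lattice `L`: a residuated map `f` with residual `g` such that
`g (f x) = x ⊔ g ⊥` and `f (g y) = y ⊓ f ⊤`. Equivalently, `f` sends `x` to the image of `x ⊔ k`
under an isomorphism of `[k, ⊤]` onto `[⊥, a]`, where `k = g ⊥` and `a = f ⊤`. -/
structure NormalMap where
  /-- The underlying map. -/
  toFun : L → L
  /-- The upper adjoint of the underlying map. -/
  residual : L → L
  gc : GaloisConnection toFun residual
  residual_apply : ∀ x, residual (toFun x) = x ⊔ residual ⊥
  apply_residual : ∀ y, toFun (residual y) = y ⊓ toFun ⊤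

namespace NormalMap

theorem ext' {f g : NormalMap L} (h : ∀ x, f.toFun x = g.toFun x) : f = g := by
  have h2 : f.residual = g.residual := funext fun y => f.gc.u_unique g.gc h
  obtain ⟨f, f', _, _, _⟩ := f
  obtain ⟨g, g', _, _, _⟩ := g
  obtain rfl : f = g := funext h
  obtain rfl : f' = g' := h2
  rfl

variable [IsModularLattice L]

/-- Normal maps are written on the right: `f * g` is `f` followed by `g`. -/
instance : Monoid (NormalMap L) where
  mul f g :=
    { toFun := fun x => g.toFun (f.toFun x)
      residual := fun y => f.residual (g.residual y)
      gc := f.gc.compose g.gc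
      residual_apply := fun x => by
        have h1 : ∀ y, f.residual y = f.residual (y ⊓ f.toFun ⊤) := fun y => by
          rw [← f.apply_residual, f.gc.u_l_u_eq_u]
        rw [g.residual_apply, h1, sup_inf_assoc_of_le _ (f.gc.monotone_l le_top),
          ← f.apply_residual, ← f.gc.l_sup, f.residual_apply, sup_assoc,
          sup_eq_left.2 (f.gc.monotone_u bot_le)]
      apply_residual := fun y => by
        have h1 : ∀ y, g.toFun y = g.toFun (y ⊔ g.residual ⊥) := fun y => by
          rw [← g.residual_apply, g.gc.l_u_l_eq_l]
        rw [f.apply_residual, h1, inf_sup_assoc_of_le _ (g.gc.monotone_u bot_le),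
          ← g.residual_apply, ← g.gc.u_inf, g.apply_residual, inf_assoc,
          inf_eq_left.2 (g.gc.monotone_l le_top)] }
  one :=
    { toFun := id
      residual := id
      gc := GaloisConnection.id
      residual_apply := fun x => by simp
      apply_residual := fun x => by simp }
  mul_assoc _ _ _ := rfl
  one_mul _ := rfl
  mul_one _ := rfl

theorem mul_toFun (f g : NormalMap L) (x : L) : (f * g).toFun x = g.toFun (f.toFun x) := rfl

/-- The projection onto `[⊥, n]` along a complement `v` of `n`. -/
def proj (n v : L) (h : IsCompl n v) : NormalMap L where
  toFun x := (x ⊔ v) ⊓ n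
  residual y := (y ⊓ n) ⊔ v
  gc x y := by
    constructor
    · intro hxy
      calc x ≤ x ⊔ v := le_sup_left
        _ = ((x ⊔ v) ⊓ n) ⊔ v := (h.inf_sup_eq_of_le le_sup_right).symm
        _ ≤ (y ⊓ n) ⊔ v := sup_le_sup_right (le_inf hxy inf_le_right) _
    · intro hxy
      calc (x ⊔ v) ⊓ n ≤ ((y ⊓ n) ⊔ v) ⊓ n := inf_le_inf_right _ (sup_le hxy le_sup_right)
        _ = y ⊓ n := h.sup_inf_eq_of_le inf_le_right
        _ ≤ y := inf_le_left
  residual_apply x := by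
    rw [inf_assoc, inf_idem, h.inf_sup_eq_of_le le_sup_right, bot_inf_eq, bot_sup_eq]
  apply_residual y := by
    rw [sup_assoc, sup_idem, h.sup_inf_eq_of_le inf_le_right, top_sup_eq, top_inf_eq]

theorem proj_toFun {n v : L} (h : IsCompl n v) (x : L) : (proj n v h).toFun x = (x ⊔ v) ⊓ n := rfl

theorem proj_toFun_of_le {n v x : L} (h : IsCompl n v) (hx : x ≤ n) : (proj n v h).toFun x = x :=
  h.sup_inf_eq_of_le hx

theorem proj_toFun_le {n v : L} (h : IsCompl n v) (x : L) : (proj n v h).toFun x ≤ n :=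
  inf_le_right

theorem proj_toFun_eq_bot_iff {n v x : L} (h : IsCompl n v) :
    (proj n v h).toFun x = ⊥ ↔ x ≤ v := by
  rw [← le_bot_iff, (proj n v h).gc]
  simp [proj]

theorem isIdempotentElem_proj {n v : L} (h : IsCompl n v) : IsIdempotentElem (proj n v h) :=
  ext' fun x => proj_toFun_of_le h (proj_toFun_le h x)

theorem proj_toFun_top {n v : L} (h : IsCompl n v) : (proj n v h).toFun ⊤ = n := by
  simp [proj]

theorem proj_residual_bot {n v : L} (h : IsCompl n v) : (proj n v h).residual ⊥ = v := by
  simp [proj]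

theorem exists_eq_proj {f : NormalMap L} (hf : IsIdempotentElem f) :
    ∃ n v, ∃ h : IsCompl n v, f = proj n v h := by
  have hff : ∀ x, f.toFun (f.toFun x) = f.toFun x := fun x => by rw [← mul_toFun, hf.eq]
  have hgg : ∀ y, f.residual (f.residual y) = f.residual y := fun y => by
    change (f * f).residual y = _
    rw [hf.eq]
  have hc : IsCompl (f.toFun ⊤) (f.residual ⊥) := by
    refine IsCompl.of_eq ?_ ?_
    · rw [inf_comm, ← f.apply_residual, hgg]
      exact f.gc.l_u_bot
    · rw [← f.residual_apply, hff]
      exact f.gc.u_l_top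
  refine ⟨_, _, hc, ext' fun x => ?_⟩
  rw [proj_toFun, ← f.residual_apply, ← f.apply_residual, hgg, f.gc.l_u_l_eq_l]

theorem isRegularSemigroup [ComplementedLattice L] : IsRegularSemigroup (NormalMap L) := by
  intro f
  obtain ⟨b, hb⟩ := exists_isCompl (f.residual ⊥)
  obtain ⟨c, hc⟩ := exists_isCompl (f.toFun ⊤)
  have hfk : ∀ x, f.toFun (x ⊔ f.residual ⊥) = f.toFun x := fun x => by
    rw [← f.residual_apply, f.gc.l_u_l_eq_l]
  have hk : ∀ y, f.residual ⊥ ≤ f.residual y := fun y => f.gc.monotone_u bot_le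
  have ha : ∀ x, f.toFun x ≤ f.toFun ⊤ := fun x => f.gc.monotone_l le_top
  have hfg : ∀ y, f.toFun (f.residual ((y ⊔ c) ⊓ f.toFun ⊤) ⊓ b) = (y ⊔ c) ⊓ f.toFun ⊤ := by
    intro y
    rw [← hfk, hb.symm.inf_sup_eq_of_le (hk _), f.apply_residual, inf_assoc, inf_idem]
  have hgf : ∀ x, f.residual ((f.toFun (x ⊓ b) ⊔ c) ⊓ f.toFun ⊤) ⊓ b = x ⊓ b := by
    intro x
    rw [hc.sup_inf_eq_of_le (ha _), f.residual_apply, hb.symm.sup_inf_eq_of_le inf_le_right]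
  have hgc : GaloisConnection (fun y => f.residual ((y ⊔ c) ⊓ f.toFun ⊤) ⊓ b)
      (fun x => f.toFun (x ⊓ b) ⊔ c) := by
    intro y x
    constructor
    · intro h
      calc y ≤ ((y ⊔ c) ⊓ f.toFun ⊤) ⊔ c := by
            rw [hc.inf_sup_eq_of_le le_sup_right]; exact le_sup_left
        _ ≤ f.toFun (x ⊓ b) ⊔ c := by
            rw [← hfg]; exact sup_le_sup_right (f.gc.monotone_l (le_inf h inf_le_right)) _
    · intro h
      calc f.residual ((y ⊔ c) ⊓ f.toFun ⊤) ⊓ b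
          ≤ f.residual ((f.toFun (x ⊓ b) ⊔ c) ⊓ f.toFun ⊤) ⊓ b :=
            inf_le_inf_right _ (f.gc.monotone_u (inf_le_inf_right _ (sup_le h le_sup_right)))
        _ = x ⊓ b := hgf x
        _ ≤ x := inf_le_left
  -- The quasi-inverse projects onto `[⊥, f ⊤]`, applies the inverse of the isomorphism that `f`
  -- induces, and projects along the kernel of `f`.
  refine ⟨⟨_, _, hgc, fun y => ?_, fun x => ?_⟩, ext' fun x => ?_⟩
  · rw [inf_assoc, inf_idem, hfg, hc.inf_sup_eq_of_le le_sup_right, bot_inf_eq, f.gc.l_bot,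
      bot_sup_eq]
  · rw [sup_assoc, sup_idem, hgf, top_sup_eq, top_inf_eq, f.gc.u_l_top, top_inf_eq]
  · change f.toFun (f.residual ((f.toFun x ⊔ c) ⊓ f.toFun ⊤) ⊓ b) = f.toFun x
    rw [hfg, hc.sup_inf_eq_of_le (ha _)]

end NormalMap

/-! ### A criterion for modularity -/

/-- A lattice is modular if the two members of each complementary pair form a modular and a dually
modular pair, and complements can be chosen antitonically. -/
theorem isModularLattice_of_isCompl
    (hle : ∀ n v x : L, IsCompl n v → x ≤ n → (x ⊔ v) ⊓ n ≤ x)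
    (hge : ∀ n v x : L, IsCompl n v → v ≤ x → x ≤ (x ⊓ n) ⊔ v)
    (hrel : ∀ w z f : L, w ≤ z → IsCompl z f → ∃ w', IsCompl w w' ∧ f ≤ w') :
    IsModularLattice L := by
  have hcompl : ∀ z : L, ∃ f, IsCompl z f := fun z =>
    (hrel z ⊤ ⊥ le_top isCompl_top_bot).imp fun _ h => h.1
  have hrc : ∀ w z : L, w ≤ z → ∃ t, t ⊓ w = ⊥ ∧ t ⊔ w = z := by
    intro w z hwz
    obtain ⟨f, hf⟩ := hcompl z
    obtain ⟨w', hw, hfw⟩ := hrel w z f hwz hf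
    refine ⟨w' ⊓ z, ?_, le_antisymm (sup_le inf_le_right hwz) ?_⟩
    · rw [inf_right_comm, inf_comm w', hw.inf_eq_bot, bot_inf_eq]
    · have h1 : ⊤ ≤ (w' ⊓ z ⊔ w) ⊔ f := by
        rw [← hw.sup_eq_top, sup_right_comm]
        exact sup_le le_sup_right ((hge z f w' hf hfw).trans le_sup_left)
      calc z = ⊤ ⊓ z := (top_inf_eq z).symm
        _ ≤ ((w' ⊓ z ⊔ w) ⊔ f) ⊓ z := inf_le_inf_right _ h1
        _ ≤ w' ⊓ z ⊔ w := hle z f _ hf (sup_le inf_le_right hwz)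
  -- There is no pentagon `x < z` with `x ⊓ y = z ⊓ y` and `x ⊔ y = z ⊔ y`.
  have key : ∀ x y z : L, x ≤ z → z ⊓ y ≤ x → z ≤ x ⊔ y → z ≤ x := by
    intro x y z hxz hw hu
    obtain ⟨s, hs⟩ := hcompl (z ⊔ y)
    obtain ⟨r, hr1, hr2⟩ := hrc (z ⊓ y) y inf_le_right
    have hry : r ≤ y := hr2 ▸ le_sup_left
    -- With `s` a complement of `z ⊔ y` and `r` one of `z ⊓ y` in `[⊥, y]`, the element `r ⊔ s` is a
    -- complement of `z` whose join with `x` is also `⊤`; now `x ≤ z` and the modular pair `z`,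
    -- `r ⊔ s` give `x = z`.
    have hc : IsCompl z (r ⊔ s) := by
      refine IsCompl.of_eq (le_bot_iff.1 ?_) (top_le_iff.1 ?_)
      · calc z ⊓ (r ⊔ s) ≤ z ⊓ r := le_inf inf_le_left
              (le_trans (le_inf inf_le_right (inf_le_left.trans le_sup_left))
                (hle _ s r hs (hry.trans le_sup_right)))
          _ ≤ r ⊓ (z ⊓ y) := le_inf inf_le_right (inf_le_inf_left _ hry)
          _ = ⊥ := hr1
      · rw [← hs.sup_eq_top]
        refine sup_le (sup_le le_sup_left ?_) (le_sup_right.trans le_sup_right)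
        exact hr2.ge.trans (sup_le (le_sup_left.trans le_sup_right)
          (inf_le_left.trans le_sup_left))
    have ht : ⊤ ≤ x ⊔ (r ⊔ s) := by
      rw [← hs.sup_eq_top]
      have hy : y ≤ x ⊔ (r ⊔ s) := hr2.ge.trans
        (sup_le (le_sup_left.trans le_sup_right) (hw.trans le_sup_left))
      exact sup_le (sup_le (hu.trans (sup_le le_sup_left hy)) hy)
        (le_sup_right.trans le_sup_right)
    calc z ≤ (x ⊔ (r ⊔ s)) ⊓ z := le_inf (le_top.trans ht) le_rfl
      _ ≤ x := hle z _ x hc hxz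
  refine ⟨fun {x} y {z} hxz => key (x ⊔ y ⊓ z) y ((x ⊔ y) ⊓ z) ?_ ?_ ?_⟩
  · exact sup_le (le_inf le_sup_left hxz) (inf_le_inf_right _ le_sup_right)
  · exact le_sup_of_le_right (le_inf inf_le_right (inf_le_left.trans inf_le_right))
  · exact inf_le_left.trans (sup_le (le_sup_left.trans le_sup_left) le_sup_right)

end Lattice

/-! ### Semigroups generated by idempotents -/

section Semigroups

/-- The subsemigroup generated by the idempotents of a regular monoid is regular, because it
contains every `x'` with `x'xx' = x'` for each of its elements `x`: if `x = e₁ ⋯ eₙ` then `x'` is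
the product of the idempotents `eⱼ₊₁ ⋯ eₙ x' e₁ ⋯ eⱼ`, with `j` descending from `n` to `0`. -/
theorem isRegularSemigroup_closure {M : Type u} [Monoid M] (hM : IsRegularSemigroup M) :
    IsRegularSemigroup (Subsemigroup.closure {e : M | IsIdempotentElem e}) := by
  have key : ∀ z ∈ Subsemigroup.closure {e : M | IsIdempotentElem e}, ∀ y w t : M,
      t * y * z * w * t = t → t * y * z ∈ Subsemigroup.closure {e : M | IsIdempotentElem e} →
      t * y ∈ Subsemigroup.closure {e : M | IsIdempotentElem e} := by
    intro z hz
    induction hz using Subsemigroup.closure_induction with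
    | mem e he =>
      intro y w t ht h
      have h1 : t * y = (t * y * e) * (e * w * t * y) := by
        calc t * y = (t * y * e * w * t) * y := by rw [ht]
          _ = t * y * (e * e) * w * t * y := by rw [he.eq]
          _ = _ := by simp only [mul_assoc]
      rw [h1]
      refine mul_mem h (Subsemigroup.subset_closure ?_)
      change (e * w * t * y) * (e * w * t * y) = e * w * t * y
      calc (e * w * t * y) * (e * w * t * y) = e * w * (t * y * e * w * t) * y := by
            simp only [mul_assoc]
        _ = _ := by rw [ht]
    | mul a b _ _ iha ihb =>
      intro y w t ht h
      refine iha y (b * w) t (by simpa only [mul_assoc] using ht) ?_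
      have := ihb (y * a) w t (by simpa only [mul_assoc] using ht)
        (by simpa only [mul_assoc] using h)
      simpa only [mul_assoc] using this
  rintro ⟨x, hx⟩
  obtain ⟨t, ht⟩ := hM x
  have h1 : (t * x * t) * x * (t * x * t) = t * x * t := by
    calc (t * x * t) * x * (t * x * t) = t * (x * t * x) * t * x * t := by simp only [mul_assoc]
      _ = t * x * t * x * t := by rw [ht]
      _ = t * (x * t * x) * t := by simp only [mul_assoc]
      _ = t * x * t := by rw [ht]
  refine ⟨⟨t * x * t, ?_⟩, Subtype.ext ?_⟩
  · have := key x hx 1 1 (t * x * t) (by simpa only [mul_one] using h1) (Subsemigroup.subset_closure (by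
      change _ * _ = _
      simp only [mul_one]
      rw [← mul_assoc, h1]))
    simpa using this
  · change x * (t * x * t) * x = x
    calc x * (t * x * t) * x = (x * t * x) * t * x := by simp only [mul_assoc]
      _ = x := by rw [ht, ht]

theorem isIdempotentGenerated_closure {M : Type u} [Semigroup M] :
    IsIdempotentGenerated (Subsemigroup.closure {e : M | IsIdempotentElem e}) := by
  have h : {e : Subsemigroup.closure {e : M | IsIdempotentElem e} | IsIdempotentElem e} =
      Subtype.val ⁻¹' {e : M | IsIdempotentElem e} := Set.ext fun x => Subtype.ext_iff
  rw [IsIdempotentGenerated, h]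
  exact Subsemigroup.closure_closure_coe_preimage

theorem idemOp_eq_some_iff {S : Type v} [Semigroup S] {e f g : Idem S} :
    idemOp e f = some g ↔ Comparable e f ∧ (e : S) * f = g := by
  unfold idemOp
  split_ifs with h
  · simp [h, Subtype.ext_iff]
  · simp [h]

end Semigroups

/-! ### Complementary pairs as a biordered set of idempotents -/

section Representation

variable {E : Type u} {op : E → E → Option E}

/-- If `E` is the set of complementary pairs `(n e, v e)` of a complemented modular lattice, with the
quasi-orders and basic products of projections, then the projections generate a regular semigroup of
normal maps with `E` as its biordered set of idempotents. -/
theorem exists_semigroup_of_modularLattice {L : Type u} [Lattice L] [BoundedOrder L]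
    [IsModularLattice L] [ComplementedLattice L] (hE : IsBiorderedSet op) (n v : E → L)
    (hc : ∀ e, IsCompl (n e) (v e)) (hL : ∀ e f, OmL op e f ↔ n e ≤ n f)
    (hR : ∀ e f, OmR op e f ↔ v f ≤ v e) (hsurj : ∀ a b, IsCompl a b → ∃ e, n e = a ∧ v e = b)
    (hmulR : ∀ e f g, OmR op e f → op e f = some g → n g = (n e ⊔ v f) ⊓ n f ∧ v g = v e)
    (hmulL : ∀ e f g, OmL op f e → op e f = some g → n g = n f ∧ v g = (v f ⊓ n e) ⊔ v e) :
    ∃ (S : Type u) (_ : Semigroup S), IsRegularSemigroup S ∧ IsIdempotentGenerated S ∧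
      IsBiorderedSetOfIdempotents S op := by
  refine ⟨Subsemigroup.closure {f : NormalMap L | IsIdempotentElem f}, inferInstance,
    isRegularSemigroup_closure NormalMap.isRegularSemigroup, isIdempotentGenerated_closure, ?_⟩
  let p : E → NormalMap L := fun e => NormalMap.proj (n e) (v e) (hc e)
  have hp : ∀ e x, (p e).toFun x = (x ⊔ v e) ⊓ n e := fun e x => rfl
  have hpi : ∀ e, IsIdempotentElem (p e) := fun e => NormalMap.isIdempotentElem_proj _
  have hp_inj : ∀ e f, n e = n f → v e = v f → e = f := fun e f h1 h2 =>
    Option.some_injective _ (((hL e f).2 h1.le).symm.trans ((hR f e).2 h2.le))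
  have hleft : ∀ e f, p e * p f = p e ↔ OmL op e f := by
    intro e f
    rw [hL]
    constructor
    · intro h
      have h1 := congrArg (fun q => NormalMap.toFun q ⊤) h
      simp only [NormalMap.mul_toFun] at h1
      rw [NormalMap.proj_toFun_top (hc e)] at h1
      rw [← h1]
      exact NormalMap.proj_toFun_le _ _
    · intro h
      exact NormalMap.ext' fun x => NormalMap.proj_toFun_of_le (hc f)
        ((NormalMap.proj_toFun_le _ _).trans h)
  have hright : ∀ e f, p e * p f = p f ↔ OmR op f e := by
    intro e f
    rw [hR]
    constructor
    · intro h
      have h1 := congrArg (fun q => NormalMap.toFun q (v e)) h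
      simp only [NormalMap.mul_toFun] at h1
      rw [(NormalMap.proj_toFun_eq_bot_iff (hc e)).2 le_rfl, (p f).gc.l_bot] at h1
      exact (NormalMap.proj_toFun_eq_bot_iff (hc f)).1 h1.symm
    · intro h
      refine NormalMap.ext' fun x => ?_
      rw [NormalMap.mul_toFun, hp, hp, hp]
      congr 1
      rw [← sup_eq_right.2 h, ← sup_assoc, (hc e).inf_sup_eq_of_le le_sup_right, sup_assoc]
  let q : E → Subsemigroup.closure {f : NormalMap L | IsIdempotentElem f} := fun e =>
    ⟨p e, Subsemigroup.subset_closure (hpi e)⟩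
  let φ : E → Idem (Subsemigroup.closure {f : NormalMap L | IsIdempotentElem f}) := fun e =>
    ⟨q e, Subtype.ext (hpi e)⟩
  have hφ : Function.Bijective φ := by
    constructor
    · intro e f h
      have h1 : p e = p f := congrArg (fun x => (x.1 : NormalMap L)) h
      refine hp_inj e f ?_ ?_
      · rw [← NormalMap.proj_toFun_top (hc e), ← NormalMap.proj_toFun_top (hc f)]
        exact congrArg (fun x => NormalMap.toFun x ⊤) h1
      · rw [← NormalMap.proj_residual_bot (hc e), ← NormalMap.proj_residual_bot (hc f)]
        exact congrArg (fun x => NormalMap.residual x ⊥) h1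
    · rintro ⟨⟨f, hf⟩, hff⟩
      obtain ⟨a, b, hab, rfl⟩ := NormalMap.exists_eq_proj (f := f) (congrArg Subtype.val hff)
      obtain ⟨e, rfl, rfl⟩ := hsurj a b hab
      exact ⟨e, rfl⟩
  have hcomp : ∀ e f, Comparable (φ e) (φ f) ↔ ∃ g, op e f = some g := by
    intro e f
    rw [hE.b1, ← hleft, ← hright, ← hleft, ← hright]
    simp only [Comparable, φ, q, Subtype.ext_iff, MulMemClass.coe_mul]
    tauto
  refine ⟨Equiv.ofBijective φ hφ, fun e f => ?_⟩
  simp only [Equiv.ofBijective_apply]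
  cases hg : op e f with
  | none =>
    have : ¬ Comparable (φ e) (φ f) := by simp [hcomp, hg]
    simp [idemOp, this]
  | some g =>
    rw [Option.map_some]
    refine idemOp_eq_some_iff.2 ⟨(hcomp e f).2 ⟨g, hg⟩, Subtype.ext ?_⟩
    change p e * p f = p g
    rcases (hE.b1 e f).1 ⟨g, hg⟩ with (h | h) | (h | h)
    · obtain rfl : g = e := Option.some_injective _ (hg.symm.trans h)
      exact (hleft _ _).2 h
    · obtain ⟨h1, h2⟩ := hmulR e f g h hg
      refine NormalMap.ext' fun x => ?_
      rw [NormalMap.mul_toFun, hp, hp, hp, h1, h2,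
        inf_sup_assoc_of_le _ (((hR e f).1 h).trans le_sup_right), inf_assoc]
    · obtain ⟨h1, h2⟩ := hmulL e f g h hg
      refine NormalMap.ext' fun x => ?_
      have h3 : n f = n e ⊓ n f := (inf_eq_right.2 ((hL f e).1 h)).symm
      rw [NormalMap.mul_toFun, hp, hp, hp, h1, h2, h3, ← inf_assoc, ← inf_assoc,
        sup_inf_assoc_of_le _ inf_le_right, sup_left_comm x,
        sup_inf_assoc_of_le (x ⊔ v e) (inf_le_right : v f ⊓ n e ≤ n e), sup_comm (v f ⊓ n e)]
    · obtain rfl : g = f := Option.some_injective _ (hg.symm.trans h)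
      exact (hright _ _).2 h

end Representation

/-! ### The lattice of `𝓛`-classes -/

section IdealLattice

variable {E : Type u} {op : E → E → Option E} {zero : E} {compl : E → E}

variable (op) in
/-- The partially ordered set `E/𝓛` of `𝓛`-classes. The class of `e` is represented by the set
`ω^l(e)` of the elements `ω^l`-below `e`, so that the order is inclusion. -/
abbrev LeftIdeal : Type u := {A : Set E // ∃ e, A = {f | OmL op f e}}

variable (op) in
/-- The `𝓛`-class of `e`, as the set `ω^l(e)`. -/
def down (e : E) : LeftIdeal op := ⟨{f | OmL op f e}, e, rfl⟩

theorem exists_eq_down (x : LeftIdeal op) : ∃ e, x = down op e :=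
  x.2.imp fun _ h => Subtype.ext h

namespace IsBaerBiorderedSet

variable (H : IsBaerBiorderedSet op zero compl)
include H

theorem down_le_down {e f : E} : down op e ≤ down op f ↔ OmL op e f :=
  ⟨fun h => h (H.omL_refl e), fun h g hg => H.omL_trans g e f hg h⟩

theorem down_eq_down {e f : E} (h1 : OmL op e f) (h2 : OmL op f e) : down op e = down op f :=
  le_antisymm (H.down_le_down.2 h1) (H.down_le_down.2 h2)

theorem down_compl_le_iff {e f : E} : down op (compl e) ≤ down op (compl f) ↔ OmR op f e := by
  rw [H.down_le_down, ← H.omR_iff]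

theorem exists_eq_down_compl (x : LeftIdeal op) : ∃ e, x = down op (compl e) := by
  obtain ⟨e, rfl⟩ := exists_eq_down x
  exact ⟨compl e, by rw [H.compl_compl]⟩

/-- The union of the classes of the `ge` with `g ∈ M(f,e)` is principal, by the maximality of the
elements of the sandwich set. -/
theorem setOf_mul_eq {e f h m : E} (hh : h ∈ SandwichSet op f e) (hm : op h e = some m) :
    {p | ∃ g ∈ (down op f).1, OmR op g e ∧ ∃ a, op g e = some a ∧ OmL op p a} =
      {p | OmL op p m} := by
  ext p
  constructor
  · rintro ⟨g, hgf, hge, a, ha, hpa⟩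
    exact H.omL_trans _ _ _ hpa (omL_of_mem_sandwichSet hh hm ⟨hgf, hge⟩ ha)
  · intro hp
    exact ⟨h, hh.1.1, hh.1.2, m, hm, hp⟩

omit H in
/-- The action of `e` on `E/𝓛` by right multiplication: the class of `f` goes to the greatest of the
classes of the elements `ge` with `g ∈ M(f,e)`, which is that of `he` for each `h ∈ S(f,e)`. -/
def mulRight (H : IsBaerBiorderedSet op zero compl) (e : E) (x : LeftIdeal op) : LeftIdeal op :=
  ⟨{p | ∃ g ∈ x.1, OmR op g e ∧ ∃ a, op g e = some a ∧ OmL op p a}, by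
    obtain ⟨f, rfl⟩ := exists_eq_down x
    obtain ⟨h, hh⟩ := H.sandwich_nonempty f e
    obtain ⟨m, hm, -⟩ := H.exists_mul_right hh
    exact ⟨m, H.setOf_mul_eq hh hm⟩⟩

theorem mulRight_down {e f h m : E} (hh : h ∈ SandwichSet op f e) (hm : op h e = some m) :
    H.mulRight e (down op f) = down op m :=
  Subtype.ext (H.setOf_mul_eq hh hm)

theorem mulRight_mono (e : E) {x y : LeftIdeal op} (h : x ≤ y) :
    H.mulRight e x ≤ H.mulRight e y := by
  rintro p ⟨g, hg, h1⟩
  exact ⟨g, h hg, h1⟩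

theorem setOf_mulRight_le_eq {e g k n : E} (hk : k ∈ SandwichSet op e g)
    (hn : op e k = some n) :
    {p | H.mulRight e (down op p) ≤ down op (compl g)} = {p | OmL op p (compl n)} := by
  ext p
  obtain ⟨h, hh⟩ := H.sandwich_nonempty p e
  obtain ⟨m, hm, -⟩ := H.exists_mul_right hh
  change H.mulRight e (down op p) ≤ _ ↔ OmL op p _
  rw [H.mulRight_down hh hm, H.down_le_down]
  exact H.omL_compl_assoc hh hm hk hn

omit H in
/-- The residual of the action of `e` on `E/𝓛`. Up to `e ↦ e'` it is left multiplication by `e` on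
the `𝓡`-classes. -/
def residual (H : IsBaerBiorderedSet op zero compl) (e : E) (y : LeftIdeal op) : LeftIdeal op :=
  ⟨{p | H.mulRight e (down op p) ≤ y}, by
    obtain ⟨g, rfl⟩ := H.exists_eq_down_compl y
    obtain ⟨k, hk⟩ := H.sandwich_nonempty e g
    obtain ⟨n, hn, -⟩ := H.exists_mul_left hk
    exact ⟨compl n, H.setOf_mulRight_le_eq hk hn⟩⟩

theorem residual_down_compl {e g k n : E} (hk : k ∈ SandwichSet op e g) (hn : op e k = some n) :
    H.residual e (down op (compl g)) = down op (compl n) :=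
  Subtype.ext (H.setOf_mulRight_le_eq hk hn)

theorem gc (e : E) : GaloisConnection (H.mulRight e) (H.residual e) := by
  intro x y
  obtain ⟨f, rfl⟩ := exists_eq_down x
  refine ⟨fun h p hp => ?_, fun h => h (H.omL_refl f)⟩
  exact (H.mulRight_mono e (H.down_le_down.2 hp)).trans h

theorem mulRight_le (e : E) (x : LeftIdeal op) : H.mulRight e x ≤ down op e := by
  obtain ⟨f, rfl⟩ := exists_eq_down x
  obtain ⟨h, hh⟩ := H.sandwich_nonempty f e
  obtain ⟨m, hm, -, hme⟩ := H.exists_mul_right hh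
  rw [H.mulRight_down hh hm]
  exact H.down_le_down.2 hme.1

theorem mulRight_of_le {e : E} {x : LeftIdeal op} (hx : x ≤ down op e) : H.mulRight e x = x := by
  obtain ⟨f, rfl⟩ := exists_eq_down x
  obtain ⟨h, hh⟩ := H.sandwich_nonempty f e
  obtain ⟨m, hm, -⟩ := H.exists_mul_right hh
  obtain ⟨h1, h2⟩ := H.omL_mul_of_omL (H.down_le_down.1 hx) hh hm
  rw [H.mulRight_down hh hm, H.down_eq_down h1 h2]

theorem mulRight_of_omR {e f g : E} (h : OmR op e f) (hg : op e f = some g) :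
    H.mulRight f (down op e) = down op g := by
  obtain ⟨k, hk⟩ := H.sandwich_nonempty e f
  obtain ⟨m, hm, -⟩ := H.exists_mul_right hk
  obtain ⟨h1, h2⟩ := H.omL_mul_of_omR h hk hm hg
  rw [H.mulRight_down hk hm, H.down_eq_down h1 h2]

theorem le_residual (e : E) (y : LeftIdeal op) : down op (compl e) ≤ H.residual e y := by
  obtain ⟨g, rfl⟩ := H.exists_eq_down_compl y
  obtain ⟨k, hk⟩ := H.sandwich_nonempty e g
  obtain ⟨n, hn, -, hne⟩ := H.exists_mul_left hk
  rw [H.residual_down_compl hk hn]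
  exact H.down_compl_le_iff.2 hne.2

theorem residual_of_le {e : E} {y : LeftIdeal op} (hy : down op (compl e) ≤ y) :
    H.residual e y = y := by
  obtain ⟨g, rfl⟩ := H.exists_eq_down_compl y
  obtain ⟨k, hk⟩ := H.sandwich_nonempty e g
  obtain ⟨n, hn, -⟩ := H.exists_mul_left hk
  obtain ⟨h1, h2⟩ := H.omR_mul_of_omR (H.down_compl_le_iff.1 hy) hk hn
  rw [H.residual_down_compl hk hn]
  exact le_antisymm (H.down_compl_le_iff.2 h2) (H.down_compl_le_iff.2 h1)

theorem residual_of_omL {e f g : E} (h : OmL op f e) (hg : op e f = some g) :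
    H.residual e (down op (compl f)) = down op (compl g) := by
  obtain ⟨k, hk⟩ := H.sandwich_nonempty e f
  obtain ⟨n, hn, -⟩ := H.exists_mul_left hk
  obtain ⟨h1, h2⟩ := H.omR_mul_of_omL h hk hn hg
  rw [H.residual_down_compl hk hn]
  exact le_antisymm (H.down_compl_le_iff.2 h2) (H.down_compl_le_iff.2 h1)

theorem isGLB_mulRight_residual (e : E) (x : LeftIdeal op) :
    IsGLB {down op e, x} (H.mulRight e (H.residual e x)) := by
  refine ⟨?_, fun z hz => ?_⟩
  · rintro y (rfl | rfl)
    · exact H.mulRight_le _ _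
    · exact (H.gc e).l_u_le _
  · have h1 := H.mulRight_of_le (hz (Set.mem_insert _ _))
    have h2 : z ≤ x := hz (Set.mem_insert_of_mem _ rfl)
    rw [← h1]
    exact H.mulRight_mono e ((H.gc e).le_u (h1.le.trans h2))

theorem isLUB_residual_mulRight (e : E) (x : LeftIdeal op) :
    IsLUB {down op (compl e), x} (H.residual e (H.mulRight e x)) := by
  refine ⟨?_, fun z hz => ?_⟩
  · rintro y (rfl | rfl)
    · exact H.le_residual _ _
    · exact (H.gc e).le_u_l _
  · have h1 := H.residual_of_le (hz (Set.mem_insert _ _))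
    have h2 : x ≤ z := hz (Set.mem_insert_of_mem _ rfl)
    rw [← h1]
    exact (H.gc e).monotone_u ((H.gc e).l_le (h2.trans h1.ge))

theorem exists_isGLB (x y : LeftIdeal op) : ∃ z, IsGLB {x, y} z := by
  obtain ⟨e, rfl⟩ := exists_eq_down x
  exact ⟨_, H.isGLB_mulRight_residual e y⟩

theorem exists_isLUB (x y : LeftIdeal op) : ∃ z, IsLUB {x, y} z := by
  obtain ⟨e, rfl⟩ := H.exists_eq_down_compl x
  exact ⟨_, H.isLUB_residual_mulRight e y⟩

omit H in
/-- `E/𝓛` is a lattice. -/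
@[reducible]
noncomputable def lattice (H : IsBaerBiorderedSet op zero compl) : Lattice (LeftIdeal op) where
  inf x y := (H.exists_isGLB x y).choose
  inf_le_left x y := (H.exists_isGLB x y).choose_spec.1 (Set.mem_insert _ _)
  inf_le_right x y := (H.exists_isGLB x y).choose_spec.1 (Set.mem_insert_of_mem _ rfl)
  le_inf z x y hx hy := (H.exists_isGLB x y).choose_spec.2 (by rintro w (rfl | rfl) <;> assumption)
  sup x y := (H.exists_isLUB x y).choose
  le_sup_left x y := (H.exists_isLUB x y).choose_spec.1 (Set.mem_insert _ _)
  le_sup_right x y := (H.exists_isLUB x y).choose_spec.1 (Set.mem_insert_of_mem _ rfl)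
  sup_le x y z hx hy := (H.exists_isLUB x y).choose_spec.2 (by rintro w (rfl | rfl) <;> assumption)

omit H in
/-- The bounds of `E/𝓛` are the classes of `0` and of `0'`. -/
@[reducible]
def boundedOrder (H : IsBaerBiorderedSet op zero compl) : BoundedOrder (LeftIdeal op) where
  bot := down op zero
  bot_le x := by
    obtain ⟨e, rfl⟩ := exists_eq_down x
    exact H.down_le_down.2 (H.zero_om e).1
  top := down op (compl zero)
  le_top x := by
    obtain ⟨e, rfl⟩ := exists_eq_down x
    exact H.down_le_down.2 (H.omL_compl_iff'.2 fun p _ hp => H.eq_zero_of_omR hp)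

theorem exists_semigroup :
    ∃ (S : Type u) (_ : Semigroup S), IsRegularSemigroup S ∧ IsIdempotentGenerated S ∧
      IsBiorderedSetOfIdempotents S op := by
  let _ := H.lattice
  let _ := H.boundedOrder
  have hbot : (⊥ : LeftIdeal op) = down op zero := rfl
  have htop : (⊤ : LeftIdeal op) = down op (compl zero) := rfl
  have hinf : ∀ e x, down op e ⊓ x = H.mulRight e (H.residual e x) := fun e x =>
    isGLB_pair.unique (H.isGLB_mulRight_residual e x)
  have hsup : ∀ e x, down op (compl e) ⊔ x = H.residual e (H.mulRight e x) := fun e x =>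
    isLUB_pair.unique (H.isLUB_residual_mulRight e x)
  have hsi : ∀ e x, (x ⊔ down op (compl e)) ⊓ down op e = H.mulRight e x := fun e x => by
    rw [inf_comm, sup_comm, hinf, hsup, H.residual_of_le (H.le_residual _ _),
      (H.gc e).l_u_l_eq_l]
  have his : ∀ e x, (x ⊓ down op e) ⊔ down op (compl e) = H.residual e x := fun e x => by
    rw [inf_comm, sup_comm, hinf, hsup, H.mulRight_of_le (H.mulRight_le _ _),
      (H.gc e).u_l_u_eq_u]
  have hc : ∀ e, IsCompl (down op e) (down op (compl e)) := by
    intro e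
    refine IsCompl.of_eq ?_ ?_
    · rw [hinf, H.residual_of_le le_rfl]
      exact le_bot_iff.1 ((H.gc e).l_le (H.le_residual e ⊥))
    · rw [sup_comm, hsup, H.mulRight_of_le le_rfl]
      exact top_le_iff.1 ((H.gc e).le_u (H.mulRight_le e ⊤))
  have hsurj : ∀ a b, IsCompl a b → ∃ e, down op e = a ∧ down op (compl e) = b := by
    intro a b hab
    obtain ⟨f, rfl⟩ := exists_eq_down a
    obtain ⟨e, rfl⟩ := H.exists_eq_down_compl b
    obtain ⟨h, hh⟩ := H.sandwich_nonempty f e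
    refine ⟨h, H.down_eq_down hh.1.1 (H.omL_sandwich_of_disjoint hh fun p hpf hpe => ?_),
      le_antisymm (H.down_compl_le_iff.2 (H.omR_sandwich_of_disjoint hh fun p hpe hpf => ?_))
        (H.down_compl_le_iff.2 hh.1.2)⟩
    · refine H.eq_zero_of_omL (H.down_le_down.1 ?_)
      rw [← hbot, ← hab.inf_eq_bot]
      exact le_inf (H.down_le_down.2 hpf) (H.down_le_down.2 hpe)
    · refine H.eq_zero_of_omR (H.down_compl_le_iff.1 ?_)
      rw [← htop, ← hab.sup_eq_top]
      refine sup_le (H.down_le_down.2 ?_) (H.down_compl_le_iff.2 hpe)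
      rwa [H.omR_iff, H.compl_compl] at hpf
  have : IsModularLattice (LeftIdeal op) := by
    refine isModularLattice_of_isCompl ?_ ?_ ?_
    · intro n v x hnv hx
      obtain ⟨e, rfl, rfl⟩ := hsurj n v hnv
      rw [hsi, H.mulRight_of_le hx]
    · intro n v x hnv hx
      obtain ⟨e, rfl, rfl⟩ := hsurj n v hnv
      rw [his, H.residual_of_le hx]
    · intro w z f hw hzf
      obtain ⟨e, rfl, rfl⟩ := hsurj z f hzf
      obtain ⟨p, rfl⟩ := exists_eq_down w
      obtain ⟨a, -, ⟨hpa, hap⟩, hae⟩ := H.b21' e p (H.down_le_down.1 hw)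
      refine ⟨down op (compl a), ?_, H.down_compl_le_iff.2 hae.2⟩
      rw [H.down_eq_down hpa hap]
      exact hc a
  have : ComplementedLattice (LeftIdeal op) := ⟨fun x => by
    obtain ⟨e, rfl⟩ := exists_eq_down x
    exact ⟨_, hc e⟩⟩
  refine exists_semigroup_of_modularLattice H.toIsBiorderedSet (down op)
    (fun e => down op (compl e)) hc (fun e f => H.down_le_down.symm)
    (fun e f => H.down_compl_le_iff.symm) hsurj (fun e f g h hg => ?_) fun e f g h hg => ?_
  · obtain ⟨g', hg', ⟨h1, h2⟩, -⟩ := H.b21 f e h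
    obtain rfl : g = g' := Option.some_injective _ (hg.symm.trans hg')
    refine ⟨?_, le_antisymm (H.down_compl_le_iff.2 h1) (H.down_compl_le_iff.2 h2)⟩
    rw [hsi, H.mulRight_of_omR h hg]
  · obtain ⟨g', hg', ⟨h1, h2⟩, -⟩ := H.b21' e f h
    obtain rfl : g = g' := Option.some_injective _ (hg.symm.trans hg')
    refine ⟨H.down_eq_down h2 h1, ?_⟩
    rw [his, H.residual_of_omL h hg]

end IsBaerBiorderedSet

end IdealLattice

/-! ### Annihilators in regular idempotent-generated semigroups -/

section BaerSemigroup

variable {S : Type v} [Semigroup S]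

theorem principalLeftIdeal_eq {e s : S} (hes : ∃ t, e = t * s)
    (hse : s * e = s) : principalLeftIdeal s = {x | x * e = x} := by
  obtain ⟨t, rfl⟩ := hes
  ext x
  constructor
  · rintro (rfl | ⟨y, rfl⟩)
    · exact hse
    · exact (mul_assoc _ _ _).trans (congrArg _ hse)
  · intro hx
    exact Or.inr ⟨x * t, by rw [mul_assoc]; exact hx.symm⟩

theorem principalRightIdeal_eq {e s : S} (hes : ∃ t, e = s * t)
    (hse : e * s = s) : principalRightIdeal s = {x | e * x = x} := by
  obtain ⟨t, rfl⟩ := hes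
  ext x
  constructor
  · rintro (rfl | ⟨y, rfl⟩)
    · exact hse
    · exact (mul_assoc _ _ _).symm.trans (congrArg (· * y) hse)
  · intro hx
    exact Or.inr ⟨t * x, by rw [← mul_assoc]; exact hx.symm⟩

variable {E : Type u} {op : E → E → Option E} {zero : E} {compl : E → E}

theorem IsBaerBiorderedSet.isStronglyRegularBaer (H : IsBaerBiorderedSet op zero compl)
    (hS : IsRegularSemigroup S) (hgen : IsIdempotentGenerated S)
    (hφ : IsBiorderedSetOfIdempotents S op) :
    IsStronglyRegularBaer S := by
  obtain ⟨φ, hφ⟩ := hφ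
  have hop : ∀ e f g, op e f = some g ↔ Comparable (φ e) (φ f) ∧ (φ e : S) * φ f = φ g := by
    intro e f g
    rw [← idemOp_eq_some_iff, hφ, ← Option.map_some, (Option.map_injective φ.injective).eq_iff]
  have hL : ∀ e f, OmL op e f ↔ (φ e : S) * φ f = φ e := fun e f =>
    (hop e f e).trans ⟨fun h => h.2, fun h => ⟨Or.inl h, h⟩⟩
  have hR : ∀ e f, OmR op e f ↔ (φ f : S) * φ e = φ e := fun e f =>
    (hop f e e).trans ⟨fun h => h.2, fun h => ⟨Or.inr (Or.inl h), h⟩⟩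
  have hφ_surj : ∀ e : S, IsIdempotentElem e → ∃ a, (φ a : S) = e := fun e he =>
    ⟨φ.symm ⟨e, he⟩, by rw [Equiv.apply_symm_apply]⟩
  have hφ_idem : ∀ a, (φ a : S) * φ a = φ a := fun a => (φ a).2
  obtain ⟨z, hz⟩ : ∃ z : S, z = φ zero := ⟨_, rfl⟩
  -- In a regular semigroup a zero of the idempotents need not be a zero: consider a group.
  have hz0 : ∀ x, z * x = z ∧ x * z = z := by
    intro x
    have hx : x ∈ Subsemigroup.closure {e : S | IsIdempotentElem e} := hgen ▸ Subsemigroup.mem_top x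
    induction hx using Subsemigroup.closure_induction with
    | mem e he =>
      obtain ⟨a, rfl⟩ := hφ_surj e he
      rw [hz]
      exact ⟨(hL _ _).1 (H.zero_om a).1, (hR _ _).1 (H.zero_om a).2⟩
    | mul a b _ _ iha ihb =>
      exact ⟨by rw [← mul_assoc, iha.1, ihb.1], by rw [mul_assoc, ihb.2, iha.2]⟩
  have hmul : ∀ a b, (φ b : S) * φ a = z ↔ MSet op b a = {zero} := by
    intro a b
    rw [H.mSet_eq_zero_iff]
    constructor
    · intro h g hgb hga
      rw [hL] at hgb
      rw [hR] at hga
      refine φ.injective (Subtype.ext ?_)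
      rw [← hz, ← hφ_idem g]
      nth_rewrite 1 [← hgb]
      rw [← hga, mul_assoc, ← mul_assoc (φ b : S), h, (hz0 _).1, (hz0 _).2]
    · intro h
      obtain ⟨y, hy⟩ := hS ((φ b : S) * φ a)
      -- `ayfeyf` is idempotent for `f = φ b` and `e = φ a`, and it lies in `M(b,a)`.
      obtain ⟨c, hc⟩ := hφ_surj (φ a * y * (φ b * φ a) * y * φ b) (by
        calc _ = (φ a : S) * y * ((φ b * φ a) * y * (φ b * φ a)) * y * (φ b * φ a) * y * φ b := by
              simp only [mul_assoc]
          _ = (φ a : S) * y * (φ b * φ a) * y * (φ b * φ a) * y * φ b := by rw [hy]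
          _ = (φ a : S) * y * ((φ b * φ a) * y * (φ b * φ a)) * y * φ b := by
              simp only [mul_assoc]
          _ = _ := by rw [hy])
      have hc0 : c = zero := by
        refine h c ((hL _ _).2 ?_) ((hR _ _).2 ?_)
        · rw [hc, mul_assoc, hφ_idem]
        · rw [hc]
          simp only [← mul_assoc, hφ_idem]
      rw [hc0, ← hz] at hc
      calc (φ b : S) * φ a = (φ b * φ a) * y * (φ b * φ a) * y * (φ b * φ a) := by rw [hy, hy]
        _ = φ b * (φ a * y * (φ b * φ a) * y * φ b) * φ a := by simp only [mul_assoc]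
        _ = z := by rw [← hc, (hz0 _).2, (hz0 _).1]
  have hann_left : ∀ a x, x * φ a = z ↔ x * φ (compl a) = x := by
    intro a x
    constructor
    · intro h
      obtain ⟨y, hy⟩ := hS x
      obtain ⟨b, hb⟩ := hφ_surj (y * x) (by
        change y * x * (y * x) = y * x
        rw [mul_assoc, ← mul_assoc x, hy])
      have h1 : (φ b : S) * φ a = z := by rw [hb, mul_assoc, h, (hz0 _).2]
      rw [hmul, ← H.omL_compl_iff, hL, hb] at h1
      rw [← hy, mul_assoc x, mul_assoc x, h1]
    · intro h
      rw [← h, mul_assoc, (hmul _ _).2 ((H.omL_compl_iff _ _).1 (H.omL_refl _)), (hz0 _).2]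
  have hann_right : ∀ a x, φ a * x = z ↔ φ (compl a) * x = x := by
    intro a x
    constructor
    · intro h
      obtain ⟨y, hy⟩ := hS x
      obtain ⟨b, hb⟩ := hφ_surj (x * y) (by
        change x * y * (x * y) = x * y
        rw [← mul_assoc, hy])
      have h1 : (φ a : S) * φ b = z := by rw [hb, ← mul_assoc, h, (hz0 _).1]
      rw [hmul, ← H.omR_compl_iff, hR, hb] at h1
      rw [← hy, ← mul_assoc, h1]
    · intro h
      rw [← h, ← mul_assoc, (hmul _ _).2 ((H.omR_compl_iff _ _).1 (H.omR_refl _)), (hz0 _).1]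
  refine ⟨z, hz0, Set.Subset.antisymm ?_ ?_, Set.Subset.antisymm ?_ ?_⟩
  · rintro _ ⟨s, rfl⟩
    obtain ⟨t, ht⟩ := hS s
    obtain ⟨a, ha⟩ := hφ_surj (s * t) (by
      change s * t * (s * t) = s * t
      rw [← mul_assoc, ht])
    refine ⟨φ (compl a), ?_⟩
    rw [principalLeftIdeal_eq ⟨_, (hφ_idem _).symm⟩ (hφ_idem _)]
    refine Set.ext fun x => (hann_left a x).symm.trans ?_
    rw [ha]
    change _ ↔ x * s = z
    refine ⟨fun h => ?_, fun h => by rw [← mul_assoc, h, (hz0 _).1]⟩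
    rw [← ht, ← mul_assoc, h, (hz0 _).1]
  · rintro _ ⟨s, rfl⟩
    obtain ⟨t, ht⟩ := hS s
    obtain ⟨a, ha⟩ := hφ_surj (t * s) (by
      change t * s * (t * s) = t * s
      rw [mul_assoc, ← mul_assoc s, ht])
    refine ⟨φ (compl a), ?_⟩
    rw [principalLeftIdeal_eq ⟨t, ha⟩ (by rw [ha, ← mul_assoc, ht])]
    refine Set.ext fun x => (hann_left _ x).trans ?_
    rw [H.compl_compl]
    rfl
  · rintro _ ⟨s, rfl⟩
    obtain ⟨t, ht⟩ := hS s
    obtain ⟨a, ha⟩ := hφ_surj (t * s) (by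
      change t * s * (t * s) = t * s
      rw [mul_assoc, ← mul_assoc s, ht])
    refine ⟨φ (compl a), ?_⟩
    rw [principalRightIdeal_eq ⟨_, (hφ_idem _).symm⟩ (hφ_idem _)]
    refine Set.ext fun x => (hann_right a x).symm.trans ?_
    rw [ha]
    change _ ↔ s * x = z
    refine ⟨fun h => ?_, fun h => by rw [mul_assoc, h, (hz0 _).2]⟩
    rw [← ht, mul_assoc s, mul_assoc s, h, (hz0 _).2]
  · rintro _ ⟨s, rfl⟩
    obtain ⟨t, ht⟩ := hS s
    obtain ⟨a, ha⟩ := hφ_surj (s * t) (by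
      change s * t * (s * t) = s * t
      rw [← mul_assoc, ht])
    refine ⟨φ (compl a), ?_⟩
    rw [principalRightIdeal_eq ⟨t, ha⟩ (by rw [ha, ht])]
    refine Set.ext fun x => (hann_right _ x).trans ?_
    rw [H.compl_compl]
    rfl

end BaerSemigroup

end Biorder

theorem theorem3p1 {E : Type u} (op : E → E → Option E)
    (hE : Biorder.IsRegularBiorderedSet op)
    (zero : E) (h1 : ∀ e, Biorder.Om op zero e)
    (compl : E → E)
    (h21 : ∀ e, compl (compl e) = e)
    (h22 : ∀ e f, Biorder.OmL op f e ↔ Biorder.OmR op (compl e) (compl f))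
    (h23 : ∀ e f, Biorder.OmL op f (compl e) ↔ Biorder.MSet op f e = {zero}) :
    (∃ (S : Type u) (_ : Semigroup S),
      Biorder.IsRegularSemigroup S ∧ Biorder.IsIdempotentGenerated S ∧
      Biorder.IsBiorderedSetOfIdempotents S op ∧ Biorder.IsStronglyRegularBaer S) ∧
    (∀ (S : Type v) [Semigroup S],
      Biorder.IsRegularSemigroup S → Biorder.IsIdempotentGenerated S →
      Biorder.IsBiorderedSetOfIdempotents S op → Biorder.IsStronglyRegularBaer S) := by
  have H : Biorder.IsBaerBiorderedSet op zero compl := ⟨hE, h1, h21, h22, h23⟩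
  obtain ⟨S, hS, hreg, hgen, hidem⟩ := H.exists_semigroup
  exact ⟨⟨S, hS, hreg, hgen, hidem, H.isStronglyRegularBaer hreg hgen hidem⟩,
    fun T _ hT hT' hT'' => H.isStronglyRegularBaer hT hT' hT''⟩
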